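/- Let $G$ be a finite simple graph with vertex set $V$, $n=|V|$. An orthogonal labeling of $G$ (of any dimension $d\ge 1$) assigns to each $v\in V$ a vector $a_v\in\mathbb{R}^d$ such that $a_u\cdot a_v=0$ whenever $u\ne v$ are non-adjacent. The cost of a vector $p=(p_1,\dots,p_d)$ is $c(p)=p_1^2/\|p\|^2$ if $p\neq 0$, and $c(0)=0$. Let $\mathrm{STAB}(G)\subseteq\mathbb{R}^V$ be the convex hull of the characteristic vectors of the stable (independent) sets of $G$, let $$\mathrm{QSTAB}(G)=\Big\{x\ge 0 : \sum_{v\in Q}x_v\le 1\text{ for all cliques }Q\text{ of }G\Big\},$$ $$\mathrm{TH}(G)=\Big\{x\ge 0 : \sum_{v\in V}c(a_v)x_v\le 1\text{ for all orthogonal labelings }a\text{ of }G\Big\}.$$ A polytope is a bounded set that is defined by finitely many linear inequalities. $G$ is perfect if every induced subgraph $G'$ of $G$ can be colored with $\omega(G')$ colors, where $\omega(G')$ is the size of a largest clique of $G'$. (a) If $a$ is an orthogonal labeling of $G$ and there are $n$ linearly independent vectors $x^{(1)},\dots,x^{(n)}\in\mathrm{TH}(G)$ with $\sum_{v}x^{(k)}_v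 c(a_v)=1$ for all $k$, then there is an (inclusion-)maximal clique $Q$ of $G$ such that $c(a_v)=1$ for $v\in Q$ and $c(a_v)=0$ for $v\notin Q$. (b) The following are equivalent: $\mathrm{TH}(G)$ is a polytope; $\mathrm{TH}(G)=\mathrm{QSTAB}(G)$; $\mathrm{TH}(G)=\mathrm{STAB}(G)$; $G$ is perfect. -/

import Mathlib

namespace Sandwich

/-- An orthogonal labeling of `G` of dimension `d + 1` assigns to each vertex `v` a vector `a v` of
dimension `d + 1` such that the vectors of distinct non-adjacent vertices are perpendicular. The
dimension is written `d + 1` because the cost below refers to the first component. -/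
def IsOrthogonalLabeling {V : Type*} (G : SimpleGraph V) {d : ℕ} (a : V → Fin (d + 1) → ℝ) : Prop :=
  ∀ u v : V, u ≠ v → ¬ G.Adj u v → a u ⬝ᵥ a v = 0

/-- The cost of a vector: `0` if the vector is zero, otherwise the square of its first component
divided by its squared length. -/
noncomputable def cost {d : ℕ} (p : Fin (d + 1) → ℝ) : ℝ :=
  open Classical in if p = 0 then 0 else p 0 ^ 2 / (p ⬝ᵥ p)

/-- The characteristic labeling of a set of vertices. -/
noncomputable def charLabeling {V : Type*} (U : Set V) : V → ℝ :=
  U.indicator (fun _ => 1)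

/-- The convex hull of the characteristic labelings of stable sets. -/
def STAB {V : Type*} (G : SimpleGraph V) : Set (V → ℝ) :=
  convexHull ℝ {x | ∃ S : Set V, G.IsIndepSet S ∧ x = charLabeling S}

/-- The nonnegative labelings that satisfy all clique constraints. -/
def QSTAB {V : Type*} (G : SimpleGraph V) : Set (V → ℝ) :=
  {x | 0 ≤ x ∧ ∀ Q : Finset V, G.IsClique (Q : Set V) → ∑ v ∈ Q, x v ≤ 1}

/-- The nonnegative labelings that satisfy all constraints given by orthogonal labelings of `G`,
of any dimension. -/
def TH {V : Type*} [Fintype V] (G : SimpleGraph V) : Set (V → ℝ) :=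
  {x | 0 ≤ x ∧ ∀ (d : ℕ) (a : V → Fin (d + 1) → ℝ), IsOrthogonalLabeling G a →
    ∑ v, cost (a v) * x v ≤ 1}

/-- A polytope: a bounded set defined by finitely many linear inequalities. -/
def IsPolytope {V : Type*} [Fintype V] (X : Set (V → ℝ)) : Prop :=
  Bornology.IsBounded X ∧
    ∃ (m : ℕ) (A : Fin m → V → ℝ) (b : Fin m → ℝ), X = {x | ∀ i, A i ⬝ᵥ x ≤ b i}

/-- `G` is perfect: every induced subgraph can be colored with as many colors as the size of its
largest clique. -/
def IsPerfect {V : Type*} (G : SimpleGraph V) : Prop :=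
  ∀ U : Set V, (G.induce U).Colorable (G.induce U).cliqueNum

end Sandwich

/-! The points of `TH G` are exactly the cost vectors of orthogonal labelings of `Gᶜ`
(`cost_mem_TH`, `exists_labeling_compl_of_mem_TH`). For `x` in `TH G` and a labeling `a`, the matrix
∑ x_v a_v a_vᵀ / ‖a_v‖² is at most the identity, so a tight constraint makes e₀ an eigenvector: ∑
x_v f_j(v) = 0 for j ≠ 0, where f_j(v) = a_v0 a_vj / ‖a_v‖². This is linear in x, so n independent
tight points force f_j = 0. Then each a_v is parallel or perpendicular to e₀, and the costs are
those of a clique, which gives (a).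

For (b), let `TH Gᶜ` be the hull of a finite set F, and realize an extreme point w of `TH G` as the
costs of a labeling of `Gᶜ`. Each f_j is orthogonal to all points of F that are tight at w, so w ± ε
f_j stays in `TH G`. Hence f_j = 0, w comes from a stable set, and `TH G = STAB G`; this in turn
gives `TH Gᶜ = QSTAB Gᶜ`. Alternating between `G` and `Gᶜ` links the first three conditions.
Perfection enters through `QSTAB G ⊆ STAB G`: a convex decomposition supplies color classes, and
vertex replication gives the converse. -/

open scoped Matrix

namespace Sandwich

/-! ### Bessel's inequality -/

section Dot

variable {ι : Type*} [Fintype ι]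

theorem dotProduct_self_nonneg' (u : ι → ℝ) : 0 ≤ u ⬝ᵥ u := by
  simpa [dotProduct] using Finset.sum_nonneg fun i (_ : i ∈ Finset.univ) => mul_self_nonneg (u i)

theorem sq_apply_le_dotProduct_self (u : ι → ℝ) (i : ι) : u i ^ 2 ≤ u ⬝ᵥ u := by
  rw [pow_two]
  exact Finset.single_le_sum (f := fun i => u i * u i) (fun i _ => mul_self_nonneg (u i))
    (Finset.mem_univ i)

/-- Bessel's inequality for a coordinate vector and pairwise orthogonal vectors. -/
theorem sum_sq_div_dotProduct_self_le_one {V : Type*} [Fintype V] (u : V → ι → ℝ)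
    (hu : ∀ v w, v ≠ w → u v ⬝ᵥ u w = 0) (i : ι) :
    ∑ v, u v i ^ 2 / (u v ⬝ᵥ u v) ≤ 1 := by
  set t := ∑ v, u v i ^ 2 / (u v ⬝ᵥ u v) with ht
  -- Coefficients of the projection z of the basis vector e_i to the span; both z_i and ‖z‖² equal
  -- t, so t² ≤ t. Zero vectors contribute 0.
  set c : V → ℝ := fun v => u v i / (u v ⬝ᵥ u v) with hc
  have hzi : (∑ v, c v • u v) i = t := by
    simp only [Finset.sum_apply, Pi.smul_apply, smul_eq_mul, ht, hc]
    exact Finset.sum_congr rfl fun v _ => by ring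
  have hzz : (∑ v, c v • u v) ⬝ᵥ (∑ v, c v • u v) = t := by
    rw [sum_dotProduct]
    refine Finset.sum_congr rfl fun v _ => ?_
    rw [dotProduct_sum, Finset.sum_eq_single v]
    · rw [smul_dotProduct, dotProduct_smul, smul_eq_mul, smul_eq_mul]
      by_cases h : u v ⬝ᵥ u v = 0
      · simp [h, hc]
      · simp only [hc]; field_simp
    · intro w _ hw
      rw [smul_dotProduct, dotProduct_smul, hu v w hw.symm]; simp
    · simp
  have h := sq_apply_le_dotProduct_self (∑ v, c v • u v) i
  rw [hzi, hzz] at h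
  nlinarith

end Dot

/-! ### Costs, tight constraints, and the inclusions between STAB, TH and QSTAB -/

section Cost

variable {V : Type*}

theorem cost_eq {d : ℕ} (p : Fin (d + 1) → ℝ) : cost p = p 0 ^ 2 / (p ⬝ᵥ p) := by
  unfold cost
  split_ifs with h
  · simp [h]
  · rfl

theorem cost_nonneg {d : ℕ} (p : Fin (d + 1) → ℝ) : 0 ≤ cost p := by
  rw [cost_eq]
  exact div_nonneg (sq_nonneg _) (dotProduct_self_nonneg' p)

/-- Coordinates adapted to a given handle `h`: an isometry that sends `h / ‖h‖` to the first
basis vector. -/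
theorem exists_adapted_coordinates {ι : Type*} [Fintype ι] (a : V → ι → ℝ) (h : ι → ℝ)
    (hh : h ⬝ᵥ h ≠ 0) :
    ∃ (d : ℕ) (b : V → Fin (d + 1) → ℝ), (∀ u v, b u ⬝ᵥ b v = a u ⬝ᵥ a v) ∧
      ∀ v, cost (b v) = (h ⬝ᵥ a v) ^ 2 / (h ⬝ᵥ h) / (a v ⬝ᵥ a v) := by
  have hpos : 0 < h ⬝ᵥ h := lt_of_le_of_ne (dotProduct_self_nonneg' h) hh.symm
  set s := Real.sqrt (h ⬝ᵥ h) with hs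
  have hs2 : s ^ 2 = h ⬝ᵥ h := Real.sq_sqrt hpos.le
  have hs0 : s ≠ 0 := (Real.sqrt_pos.mpr hpos).ne'
  let e := Fintype.equivFin ι
  -- The component along h/‖h‖ comes first, then the whole residual in the old coordinates. Spending
  -- one extra dimension avoids choosing an orthonormal basis.
  let b : V → Fin (Fintype.card ι + 1) → ℝ := fun v =>
    Fin.cons ((h ⬝ᵥ a v) / s) (fun i => (a v - ((h ⬝ᵥ a v) / (h ⬝ᵥ h)) • h) (e.symm i))
  have hb : ∀ u v, b u ⬝ᵥ b v = a u ⬝ᵥ a v := by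
    intro u v
    have h1 : b u ⬝ᵥ b v = (h ⬝ᵥ a u) / s * ((h ⬝ᵥ a v) / s) +
        (a u - ((h ⬝ᵥ a u) / (h ⬝ᵥ h)) • h) ⬝ᵥ (a v - ((h ⬝ᵥ a v) / (h ⬝ᵥ h)) • h) := by
      simp only [b, dotProduct, Fin.sum_univ_succ, Fin.cons_zero, Fin.cons_succ]
      congr 1
      exact e.symm.sum_comp
        (fun i => (a u - ((h ⬝ᵥ a u) / (h ⬝ᵥ h)) • h) i * (a v - ((h ⬝ᵥ a v) / (h ⬝ᵥ h)) • h) i)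
    rw [h1]
    simp only [sub_dotProduct, dotProduct_sub, smul_dotProduct, dotProduct_smul, smul_eq_mul]
    rw [dotProduct_comm (a u) h, div_mul_div_comm, ← pow_two, hs2]
    field_simp
    ring
  refine ⟨_, b, hb, fun v => ?_⟩
  rw [cost_eq, hb]
  simp only [b, Fin.cons_zero, div_pow, hs2]

variable [Fintype V]

/-- The constraints of `TH G` for an arbitrary handle. -/
theorem sum_mul_sq_dotProduct_div_le {G : SimpleGraph V} {x : V → ℝ} (hx : x ∈ TH G)
    {ι : Type*} [Fintype ι] (a : V → ι → ℝ) (ha : ∀ u v, u ≠ v → ¬ G.Adj u v → a u ⬝ᵥ a v = 0)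
    (h : ι → ℝ) : ∑ v, x v * ((h ⬝ᵥ a v) ^ 2 / (a v ⬝ᵥ a v)) ≤ h ⬝ᵥ h := by
  by_cases hh : h ⬝ᵥ h = 0
  · have : h = 0 := dotProduct_self_eq_zero.mp hh
    simp [this]
  · have hpos : 0 < h ⬝ᵥ h := lt_of_le_of_ne (dotProduct_self_nonneg' h) (Ne.symm hh)
    obtain ⟨d, b, hb, hc⟩ := exists_adapted_coordinates a h hh
    have := hx.2 d b (fun u v huv hadj => by rw [hb]; exact ha u v huv hadj)
    have h2 : ∑ v, x v * ((h ⬝ᵥ a v) ^ 2 / (a v ⬝ᵥ a v)) =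
        (h ⬝ᵥ h) * ∑ v, cost (b v) * x v := by
      rw [Finset.mul_sum]
      refine Finset.sum_congr rfl fun v _ => ?_
      rw [hc]; field_simp
    rw [h2]
    nlinarith

theorem eq_zero_of_forall_quadratic_nonneg {A B : ℝ} (h : ∀ t : ℝ, 0 ≤ A * t ^ 2 + B * t) :
    B = 0 := by
  by_contra hB
  have hA : 0 < |A| + 1 := by positivity
  -- The minimizer of the quadratic after A is replaced by the positive upper bound |A| + 1.
  have := h (-B / (2 * (|A| + 1)))
  have h1 : A * (-B / (2 * (|A| + 1))) ^ 2 ≤ (|A| + 1) * (-B / (2 * (|A| + 1))) ^ 2 :=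
    mul_le_mul_of_nonneg_right (by linarith [le_abs_self A]) (sq_nonneg _)
  have h2 : (|A| + 1) * (-B / (2 * (|A| + 1))) ^ 2 + B * (-B / (2 * (|A| + 1))) =
      -(B ^ 2 / (4 * (|A| + 1))) := by field_simp; ring
  have h3 : 0 < B ^ 2 / (4 * (|A| + 1)) := by positivity
  linarith

/-- The first basis vector is an eigenvector of `∑ v, x v • a v (a v)ᵀ / ‖a v‖²` if the
constraint given by `a` is tight at `x`. -/
theorem sum_mul_eq_zero_of_tight {G : SimpleGraph V} {x : V → ℝ} (hx : x ∈ TH G) {d : ℕ}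
    {a : V → Fin (d + 1) → ℝ} (ha : IsOrthogonalLabeling G a)
    (ht : ∑ v, x v * cost (a v) = 1) {j : Fin (d + 1)} (hj : j ≠ 0) :
    ∑ v, x v * (a v 0 * a v j / (a v ⬝ᵥ a v)) = 0 := by
  -- The constraint for the handle e₀ + t e_j is an equality at t = 0, so its linear term in t must
  -- vanish.
  have key : ∀ t : ℝ, 0 ≤ (1 - ∑ v, x v * (a v j ^ 2 / (a v ⬝ᵥ a v))) * t ^ 2 +
      (-2 * ∑ v, x v * (a v 0 * a v j / (a v ⬝ᵥ a v))) * t := by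
    intro t
    have h := sum_mul_sq_dotProduct_div_le hx a ha (Pi.single 0 1 + t • Pi.single j 1)
    have h1 : (Pi.single 0 1 + t • Pi.single j 1 : Fin (d + 1) → ℝ) ⬝ᵥ
        (Pi.single 0 1 + t • Pi.single j 1) = 1 + t ^ 2 := by
      simp [hj, hj.symm]; ring
    have h2 : ∀ v, (Pi.single 0 1 + t • Pi.single j 1 : Fin (d + 1) → ℝ) ⬝ᵥ a v =
        a v 0 + t * a v j := by
      intro v; simp [add_dotProduct, smul_dotProduct]
    have h3 : ∑ v, x v * ((a v 0 + t * a v j) ^ 2 / (a v ⬝ᵥ a v)) =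
        ∑ v, x v * cost (a v) + 2 * t * ∑ v, x v * (a v 0 * a v j / (a v ⬝ᵥ a v)) +
          t ^ 2 * ∑ v, x v * (a v j ^ 2 / (a v ⬝ᵥ a v)) := by
      rw [Finset.mul_sum, Finset.mul_sum, ← Finset.sum_add_distrib, ← Finset.sum_add_distrib]
      refine Finset.sum_congr rfl fun v _ => ?_
      rw [cost_eq]; ring
    rw [h1] at h
    simp only [h2] at h
    rw [h3, ht] at h
    linarith
  have := eq_zero_of_forall_quadratic_nonneg key
  linarith

/-- If all products of the first component with the others vanish, then the costs of an
orthogonal labeling form the characteristic labeling of a clique. -/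
theorem exists_isClique_cost_eq_charLabeling {V : Type*} {G : SimpleGraph V} {d : ℕ}
    {a : V → Fin (d + 1) → ℝ} (ha : IsOrthogonalLabeling G a)
    (h : ∀ v, ∀ j ≠ 0, a v 0 * a v j / (a v ⬝ᵥ a v) = 0) :
    ∃ Q : Set V, G.IsClique Q ∧ ∀ v, cost (a v) = charLabeling Q v := by
  classical
  have hj : ∀ v, a v 0 ≠ 0 → ∀ j ≠ 0, a v j = 0 := by
    intro v hv j hj
    have h0 : a v ⬝ᵥ a v ≠ 0 := fun h0 => hv (by rw [dotProduct_self_eq_zero.mp h0]; rfl)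
    have := h v j hj
    rw [div_eq_zero_iff, mul_eq_zero] at this
    tauto
  have hdot : ∀ u v, a u 0 ≠ 0 → a u ⬝ᵥ a v = a u 0 * a v 0 := by
    intro u v hu
    exact Finset.sum_eq_single 0 (fun j _ hj0 => by rw [hj u hu j hj0, zero_mul]) (by simp)
  refine ⟨{v | a v 0 ≠ 0}, ?_, fun v => ?_⟩
  · intro u hu v hv huv
    by_contra hadj
    have := ha u v huv hadj
    rw [hdot u v hu] at this
    exact mul_ne_zero hu hv this
  · by_cases hv : a v 0 = 0
    · simp [cost_eq, charLabeling, hv]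
    · simp [cost_eq, charLabeling, hv, hdot v v hv, pow_two]

/-- The tensor products a_v ⊗ b_v are pairwise orthogonal, since two distinct vertices are
non-adjacent in `G` or in `Gᶜ`. Bessel's inequality for e₀ ⊗ e₀ is the claim. -/
theorem weak_duality {G : SimpleGraph V} {d e : ℕ} {a : V → Fin (d + 1) → ℝ}
    {b : V → Fin (e + 1) → ℝ} (ha : IsOrthogonalLabeling G a) (hb : IsOrthogonalLabeling Gᶜ b) :
    ∑ v, cost (a v) * cost (b v) ≤ 1 := by
  let u : V → Fin (d + 1) × Fin (e + 1) → ℝ := fun v p => a v p.1 * b v p.2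
  have hdot : ∀ v w, u v ⬝ᵥ u w = (a v ⬝ᵥ a w) * (b v ⬝ᵥ b w) := by
    intro v w
    simp only [u, dotProduct, Fintype.sum_prod_type, Finset.sum_mul_sum]
    exact Finset.sum_congr rfl fun i _ => Finset.sum_congr rfl fun j _ => by ring
  have hu : ∀ v w, v ≠ w → u v ⬝ᵥ u w = 0 := by
    intro v w hvw
    rw [hdot]
    by_cases hadj : G.Adj v w
    · rw [hb v w hvw (by simp [hadj]), mul_zero]
    · rw [ha v w hvw hadj, zero_mul]
  refine le_trans (le_of_eq ?_) (sum_sq_div_dotProduct_self_le_one u hu (0, 0))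
  refine Finset.sum_congr rfl fun v _ => ?_
  rw [hdot, cost_eq, cost_eq]
  simp only [u]
  rw [div_mul_div_comm, mul_pow]

theorem cost_mem_TH {G : SimpleGraph V} {e : ℕ} {b : V → Fin (e + 1) → ℝ}
    (hb : IsOrthogonalLabeling Gᶜ b) : (fun v => cost (b v)) ∈ TH G :=
  ⟨fun _ => cost_nonneg _, fun _ _ ha => weak_duality ha hb⟩

/-- The labeling that is a unit scalar on a clique and zero elsewhere. -/
theorem exists_labeling_of_isClique {V : Type*} {G : SimpleGraph V} {Q : Set V}
    (hQ : G.IsClique Q) : ∃ a : V → Fin (0 + 1) → ℝ, IsOrthogonalLabeling G a ∧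
      ∀ v, cost (a v) = charLabeling Q v := by
  classical
  refine ⟨fun v _ => charLabeling Q v, fun u v huv hadj => ?_, fun v => ?_⟩
  · by_cases hu : u ∈ Q
    · by_cases hv : v ∈ Q
      · exact absurd (hQ hu hv huv) hadj
      · simp [dotProduct, charLabeling, hv]
    · simp [dotProduct, charLabeling, hu]
  · by_cases hv : v ∈ Q <;> simp [cost_eq, dotProduct, charLabeling, hv]

theorem sum_charLabeling_mul (Q : Finset V) (x : V → ℝ) :
    ∑ v, charLabeling (Q : Set V) v * x v = ∑ v ∈ Q, x v := by
  classical
  simp [charLabeling, Set.indicator_apply]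

theorem TH_subset_QSTAB (G : SimpleGraph V) : TH G ⊆ QSTAB G := by
  intro x hx
  refine ⟨hx.1, fun Q hQ => ?_⟩
  obtain ⟨a, ha, hc⟩ := exists_labeling_of_isClique hQ
  have := hx.2 0 a ha
  simpa only [hc, sum_charLabeling_mul] using this

theorem convex_TH (G : SimpleGraph V) : Convex ℝ (TH G) := by
  intro x hx y hy s t hs ht hst
  refine ⟨add_nonneg (smul_nonneg hs hx.1) (smul_nonneg ht hy.1), fun d a ha => ?_⟩
  have h1 := hx.2 d a ha
  have h2 := hy.2 d a ha
  have : ∑ v, cost (a v) * (s • x + t • y) v =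
      s * ∑ v, cost (a v) * x v + t * ∑ v, cost (a v) * y v := by
    rw [Finset.mul_sum, Finset.mul_sum, ← Finset.sum_add_distrib]
    exact Finset.sum_congr rfl fun v _ => by simp only [Pi.add_apply, Pi.smul_apply, smul_eq_mul]; ring
  rw [this]
  nlinarith

theorem isClosed_TH (G : SimpleGraph V) : IsClosed (TH G) := by
  have : TH G = {x | 0 ≤ x} ∩ ⋂ (d : ℕ) (a : V → Fin (d + 1) → ℝ) (_ : IsOrthogonalLabeling G a),
      {x | ∑ v, cost (a v) * x v ≤ 1} := by
    ext x; simp [TH]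
  rw [this]
  refine isClosed_Ici.inter (isClosed_iInter fun d => isClosed_iInter fun a => isClosed_iInter
    fun _ => isClosed_le (by fun_prop) continuous_const)

theorem QSTAB_subset_Icc {V : Type*} (G : SimpleGraph V) : QSTAB G ⊆ Set.Icc 0 1 := by
  intro x hx
  refine ⟨hx.1, fun v => ?_⟩
  simpa using hx.2 {v} (by simp)

theorem isBounded_QSTAB (G : SimpleGraph V) : Bornology.IsBounded (QSTAB G) :=
  (Metric.isBounded_Icc 0 1).subset (QSTAB_subset_Icc G)

theorem isCompact_TH (G : SimpleGraph V) : IsCompact (TH G) :=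
  Metric.isCompact_of_isClosed_isBounded (isClosed_TH G)
    ((isBounded_QSTAB G).subset (TH_subset_QSTAB G))

theorem charLabeling_mem_TH {G : SimpleGraph V} {S : Set V} (hS : G.IsIndepSet S) :
    charLabeling S ∈ TH G := by
  obtain ⟨b, hb, hc⟩ := exists_labeling_of_isClique ((G.isClique_compl).mpr hS)
  have := cost_mem_TH hb
  simpa only [hc] using this

theorem STAB_subset_TH (G : SimpleGraph V) : STAB G ⊆ TH G :=
  convexHull_min (by rintro _ ⟨S, hS, rfl⟩; exact charLabeling_mem_TH hS) (convex_TH G)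

theorem finite_stable_charLabeling (G : SimpleGraph V) :
    {x : V → ℝ | ∃ S : Set V, G.IsIndepSet S ∧ x = charLabeling S}.Finite := by
  refine (Set.finite_range (fun S : Set V => charLabeling S)).subset ?_
  rintro _ ⟨S, -, rfl⟩
  exact ⟨S, rfl⟩

theorem isClosed_STAB (G : SimpleGraph V) : IsClosed (STAB G) :=
  (finite_stable_charLabeling G).isClosed_convexHull ℝ

/-- Points of `TH G` are recognized by testing them against generators of `TH Gᶜ`. -/
theorem mem_TH_of_compl_eq_convexHull {G : SimpleGraph V} {F : Set (V → ℝ)}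
    (h : TH Gᶜ = convexHull ℝ F) {x : V → ℝ} (hx : 0 ≤ x) (hF : ∀ p ∈ F, ∑ v, p v * x v ≤ 1) :
    x ∈ TH G := by
  refine ⟨hx, fun d a ha => ?_⟩
  have hmem : (fun v => cost (a v)) ∈ TH Gᶜ := cost_mem_TH (by rwa [compl_compl])
  rw [h] at hmem
  have hconv : Convex ℝ {y : V → ℝ | ∑ v, y v * x v ≤ 1} :=
    convex_halfSpace_le (f := fun y : V → ℝ => ∑ v, y v * x v)
      ⟨fun y z => by simp [add_mul, Finset.sum_add_distrib],
        fun c y => by simp [Finset.mul_sum, mul_assoc]⟩ 1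
  exact convexHull_min hF hconv hmem

/-- If the stable set bound is exact for the complement, the clique bound is exact. -/
theorem TH_eq_QSTAB_of_compl {G : SimpleGraph V} (h : TH Gᶜ = STAB Gᶜ) : TH G = QSTAB G := by
  refine (TH_subset_QSTAB G).antisymm fun x hx => mem_TH_of_compl_eq_convexHull h hx.1 ?_
  rintro _ ⟨S, hS, rfl⟩
  classical
  have := hx.2 S.toFinset (by simpa using (G.isIndepSet_compl).mp hS)
  rwa [← sum_charLabeling_mul, Set.coe_toFinset] at this

end Cost

/-! ### Gram matrices as a convex cone -/

section Gram

variable {I : Type*} [Fintype I]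

/-- The matrix of scalar products of a family of vectors. -/
def gram {J : Type*} (g : J → I → ℝ) : J → J → ℝ := fun i j => g i ⬝ᵥ g j

open scoped MatrixOrder in
theorem exists_gram_eq_of_posSemidef [DecidableEq I] {M : Matrix I I ℝ} (hM : M.PosSemidef) :
    ∃ g : I → I → ℝ, ∀ i j, g i ⬝ᵥ g j = M i j := by
  obtain ⟨B, hB⟩ := CStarAlgebra.nonneg_iff_eq_star_mul_self.mp hM.nonneg
  refine ⟨fun i k => B k i, fun i j => ?_⟩
  rw [hB]
  simp [Matrix.mul_apply, dotProduct, Matrix.star_apply]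

theorem exists_gram_eq_of_quadratic_nonneg (M : I → I → ℝ) (hs : ∀ i j, M i j = M j i)
    (hq : ∀ y : I → ℝ, 0 ≤ ∑ i, ∑ j, y i * y j * M i j) :
    ∃ g : I → I → ℝ, ∀ i j, g i ⬝ᵥ g j = M i j := by
  classical
  refine exists_gram_eq_of_posSemidef (M := Matrix.of M)
    (Matrix.PosSemidef.of_dotProduct_mulVec_nonneg ?_ fun y => ?_)
  · ext i j
    simp [Matrix.conjTranspose_apply, hs j i]
  · have := hq y
    simp only [dotProduct, Matrix.mulVec, Finset.mul_sum, Matrix.of_apply, Pi.star_apply,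
      star_trivial]
    refine this.trans_eq (Finset.sum_congr rfl fun i _ => Finset.sum_congr rfl fun j _ => by ring)

theorem quadratic_gram_nonneg {J : Type*} [Fintype J] (g : J → I → ℝ) (y : J → ℝ) :
    0 ≤ ∑ i, ∑ j, y i * y j * (g i ⬝ᵥ g j) := by
  have h := dotProduct_self_nonneg' (∑ i, y i • g i)
  simp only [sum_dotProduct, dotProduct_sum, smul_dotProduct, dotProduct_smul, smul_eq_mul,
    Finset.mul_sum] at h
  refine h.trans_eq (Finset.sum_congr rfl fun i _ => Finset.sum_congr rfl fun j _ => ?_)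
  rw [dotProduct_comm (g j)]
  ring

/-- The set of Gram matrices is a convex cone. -/
theorem exists_gram_add (g h : I → I → ℝ) {s t : ℝ} (hs : 0 ≤ s) (ht : 0 ≤ t) :
    ∃ k : I → I → ℝ, gram k = s • gram g + t • gram h := by
  obtain ⟨k, hk⟩ := exists_gram_eq_of_quadratic_nonneg (s • gram g + t • gram h)
    (fun i j => by simp [gram, dotProduct_comm (g i), dotProduct_comm (h i)]) (fun y => by
      have h1 := mul_nonneg hs (quadratic_gram_nonneg g y)
      have h2 := mul_nonneg ht (quadratic_gram_nonneg h y)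
      have := add_nonneg h1 h2
      simp only [Finset.mul_sum, ← Finset.sum_add_distrib] at this
      simp only [gram, Pi.add_apply, Pi.smul_apply, smul_eq_mul]
      exact this.trans_eq
        (Finset.sum_congr rfl fun i _ => Finset.sum_congr rfl fun j _ => by ring))
  exact ⟨k, funext fun i => funext fun j => hk i j⟩

end Gram

/-! ### Strong duality by separation -/

section Duality

variable {V : Type*} [Fintype V]

open Classical in
/-- The entries of a matrix indexed by `0` and the vertices that are prescribed for the Gram
matrix of an orthogonal labeling of the complement of `G`. -/
noncomputable def prescribedEntries (G : SimpleGraph V) :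
    (Option V → Option V → ℝ) →ₗ[ℝ] (Option V → Option V → ℝ) where
  toFun Y
    | none, none => Y none none
    -- Requiring this entry to vanish normalizes each vector so that its product with the handle
    -- equals its squared length.
    | none, some v => Y none (some v) - Y (some v) (some v)
    | some _, none => 0
    | some u, some v => if u = v ∨ G.Adj u v then Y (some u) (some v) else 0
  map_add' Y Z := by
    funext i j
    rcases i with _ | u <;> rcases j with _ | v <;> simp
    · ring
    · split_ifs <;> simp
  map_smul' c Y := by
    funext i j
    rcases i with _ | u <;> rcases j with _ | v <;> simp
    · ring

theorem prescribedEntries_diag {V : Type*} (G : SimpleGraph V) (Y : Option V → Option V → ℝ) (i : Option V) :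
    prescribedEntries G Y i i = Y i i := by
  rcases i with _ | u <;> simp [prescribedEntries]

/-- A linear image of a closed cone need not be closed. Here the diagonal is among the prescribed
entries, so convergent images have bounded Gram vectors, and a subsequence of these converges. -/
theorem isClosed_range_prescribedEntries_gram (G : SimpleGraph V) :
    IsClosed (Set.range fun g : Option V → Option V → ℝ => prescribedEntries G (gram g)) := by
  have hcont : Continuous fun g : Option V → Option V → ℝ => prescribedEntries G (gram g) := by
    refine (LinearMap.continuous_of_finiteDimensional _).comp ?_
    refine continuous_pi fun i => continuous_pi fun j => ?_
    simp only [gram, dotProduct]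
    fun_prop
  refine IsSeqClosed.isClosed fun z Z hz hZ => ?_
  choose g hg using hz
  obtain ⟨C, hC⟩ := (Metric.isBounded_range_of_tendsto z hZ).exists_norm_le
  have hgb : ∀ n, g n ∈ Metric.closedBall (0 : Option V → Option V → ℝ) (Real.sqrt C) := by
    intro n
    rw [mem_closedBall_zero_iff, pi_norm_le_iff_of_nonneg (Real.sqrt_nonneg _)]
    intro i
    rw [pi_norm_le_iff_of_nonneg (Real.sqrt_nonneg _)]
    intro j
    refine Real.abs_le_sqrt ((sq_apply_le_dotProduct_self (g n i) j).trans ?_)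
    have h1 : g n i ⬝ᵥ g n i = z n i i := by
      rw [← hg]; simp only [prescribedEntries_diag]; rfl
    rw [h1]
    exact (le_abs_self _).trans ((norm_le_pi_norm (z n i) i).trans
      ((norm_le_pi_norm (z n) i).trans (hC _ ⟨n, rfl⟩)))
  obtain ⟨g₀, -, φ, hφ, hlim⟩ := tendsto_subseq_of_bounded Metric.isBounded_closedBall hgb
  refine ⟨g₀, tendsto_nhds_unique ((hcont.tendsto g₀).comp hlim) ?_⟩
  have : (fun g => prescribedEntries G (gram g)) ∘ g ∘ φ = z ∘ φ := by
    funext n; exact hg (φ n)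
  rw [this]
  exact hZ.comp hφ.tendsto_atTop

/-- The prescribed entries of the Gram matrix of an orthogonal labeling of the complement with
costs `w`. -/
noncomputable def targetEntries (w : V → ℝ) : Option V → Option V → ℝ := by
  classical exact fun
    | none, none => 1
    | none, some _ => 0
    | some _, none => 0
    | some u, some v => if u = v then w u else 0

theorem exists_labeling_of_prescribedEntries_eq {G : SimpleGraph V} {w : V → ℝ}
    {g : Option V → Option V → ℝ} (hg : prescribedEntries G (gram g) = targetEntries w) :
    ∃ (d : ℕ) (b : V → Fin (d + 1) → ℝ), IsOrthogonalLabeling Gᶜ b ∧ ∀ v, cost (b v) = w v := by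
  have h00 : g none ⬝ᵥ g none = 1 := by
    simpa [prescribedEntries, targetEntries, gram] using congrFun (congrFun hg none) none
  have hvv : ∀ v, g (some v) ⬝ᵥ g (some v) = w v := fun v => by
    simpa [prescribedEntries, targetEntries, gram] using congrFun (congrFun hg (some v)) (some v)
  have h0v : ∀ v, g none ⬝ᵥ g (some v) = w v := fun v => by
    have := congrFun (congrFun hg none) (some v)
    simp only [prescribedEntries, targetEntries, gram, LinearMap.coe_mk, AddHom.coe_mk, hvv] at this
    linarith
  have huv : ∀ u v, G.Adj u v → g (some u) ⬝ᵥ g (some v) = 0 := fun u v huv => by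
    simpa [prescribedEntries, targetEntries, gram, huv, huv.ne] using
      congrFun (congrFun hg (some u)) (some v)
  obtain ⟨d, b, hb, hc⟩ := exists_adapted_coordinates (fun v => g (some v)) (g none) (by simp [h00])
  refine ⟨d, b, fun u v hne hadj => ?_, fun v => ?_⟩
  · rw [hb]
    refine huv u v ?_
    by_contra h
    exact hadj ((G.compl_adj u v).mpr ⟨hne, h⟩)
  · rw [hc, h00, h0v, hvv, div_one]
    by_cases h : w v = 0
    · simp [h]
    · field_simp

/-- Completing the square: adding (m₀·m_v)²/‖m_v‖² to the bracket gives (m₀·m_v + ‖m_v‖²)²/‖m_v‖²,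
and the added terms sum to at most ‖m₀‖² by the constraint with handle m₀. -/
theorem sum_add_sum_mul_nonneg_of_mem_TH {G : SimpleGraph V} {w : V → ℝ} (hw : w ∈ TH G)
    (m : Option V → Option V → ℝ)
    (hm : ∀ u v, u ≠ v → ¬ G.Adj u v → m (some u) ⬝ᵥ m (some v) = 0) :
    0 ≤ m none ⬝ᵥ m none + ∑ v, w v * (m (some v) ⬝ᵥ m (some v) + 2 * m none ⬝ᵥ m (some v)) := by
  have h := sum_mul_sq_dotProduct_div_le hw (fun v => m (some v)) hm (m none)
  have h2 : 0 ≤ ∑ v, (w v * ((m none ⬝ᵥ m (some v)) ^ 2 / (m (some v) ⬝ᵥ m (some v))) +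
      w v * (m (some v) ⬝ᵥ m (some v) + 2 * m none ⬝ᵥ m (some v))) := by
    refine Finset.sum_nonneg fun v _ => ?_
    rw [← mul_add]
    refine mul_nonneg (hw.1 v) ?_
    by_cases h0 : m (some v) ⬝ᵥ m (some v) = 0
    · have : m (some v) = 0 := dotProduct_self_eq_zero.mp h0
      simp [this]
    · have hpos : 0 < m (some v) ⬝ᵥ m (some v) :=
        lt_of_le_of_ne (dotProduct_self_nonneg' _) (Ne.symm h0)
      have : (m none ⬝ᵥ m (some v)) ^ 2 / (m (some v) ⬝ᵥ m (some v)) +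
          (m (some v) ⬝ᵥ m (some v) + 2 * m none ⬝ᵥ m (some v)) =
          (m none ⬝ᵥ m (some v) + m (some v) ⬝ᵥ m (some v)) ^ 2 /
            (m (some v) ⬝ᵥ m (some v)) := by
        field_simp; ring
      rw [this]
      positivity
  rw [Finset.sum_add_distrib] at h2
  linarith

/-- Every point of `TH G` consists of the costs of an orthogonal labeling of the complement. -/
theorem exists_labeling_compl_of_mem_TH {G : SimpleGraph V} {w : V → ℝ} (hw : w ∈ TH G) :
    ∃ (d : ℕ) (b : V → Fin (d + 1) → ℝ), IsOrthogonalLabeling Gᶜ b ∧ ∀ v, cost (b v) = w v := by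
  classical
  by_contra hcon
  set K := Set.range fun g : Option V → Option V → ℝ => prescribedEntries G (gram g) with hK
  have hT : targetEntries w ∉ K := by
    rintro ⟨g, hg⟩
    exact hcon (exists_labeling_of_prescribedEntries_eq hg)
  have hcone : ∀ {x y : Option V → Option V → ℝ}, x ∈ K → y ∈ K → ∀ {s t : ℝ}, 0 ≤ s → 0 ≤ t →
      s • x + t • y ∈ K := by
    rintro _ _ ⟨g, rfl⟩ ⟨h, rfl⟩ s t hs ht
    obtain ⟨k, hk⟩ := exists_gram_add g h hs ht
    exact ⟨k, by simp only [hk, map_add, map_smul]⟩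
  obtain ⟨f, u, hf, hu⟩ := geometric_hahn_banach_closed_point
    (fun x hx y hy s t hs ht _ => hcone hx hy hs ht) (isClosed_range_prescribedEntries_gram G) hT
  have hu0 : 0 < u := by
    have : (0 : Option V → Option V → ℝ) ∈ K := ⟨0, by
      have : gram (0 : Option V → Option V → ℝ) = 0 := by funext i j; simp [gram]
      simp only [this, map_zero]⟩
    simpa using hf 0 this
  have hfle : ∀ x ∈ K, f x ≤ 0 := by
    intro x hx
    by_contra! hpos
    have := hf ((u / f x) • x + (0 : ℝ) • x) (hcone hx hx (by positivity) le_rfl)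
    simp only [map_add, map_smul, smul_eq_mul, zero_mul, add_zero] at this
    rw [div_mul_cancel₀ _ hpos.ne'] at this
    exact lt_irrefl _ this
  set n : Option V → Option V → ℝ := fun i j => -f (Pi.single i (Pi.single j 1)) with hn
  have hfn : ∀ Z, -f Z = ∑ i, ∑ j, Z i j * n i j := by
    intro Z
    have hZ : Z = ∑ i, ∑ j, Z i j • (Pi.single i (Pi.single j 1) : Option V → Option V → ℝ) := by
      funext i j
      simp only [Finset.sum_apply, Pi.smul_apply, smul_eq_mul]
      rw [Finset.sum_eq_single i, Finset.sum_eq_single j]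
      · simp
      · intro b _ hb; simp [hb.symm]
      · simp
      · intro b _ hb; simp [hb.symm]
      · simp
    conv_lhs => rw [hZ]
    simp only [map_sum, map_smul, smul_eq_mul, hn, ← Finset.sum_neg_distrib, mul_neg]
  -- The symmetric matrix of y ↦ -f (prescribed entries of y yᵀ); subtracting `n none (some v)` on
  -- the diagonal accounts for the normalization entry. Its zeros at non-adjacent pairs make its
  -- Gram vectors an orthogonal labeling of `G`.
  let M : Option V → Option V → ℝ
    | none, none => n none none
    | none, some v => n none (some v) / 2
    | some v, none => n none (some v) / 2
    | some u, some v => if u = v then n (some v) (some v) - n none (some v)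
        else if G.Adj u v then (n (some u) (some v) + n (some v) (some u)) / 2 else 0
  have hMs : ∀ i j, M i j = M j i := by
    intro i j
    rcases i with _ | u <;> rcases j with _ | v <;> simp only [M]
    by_cases huv : u = v
    · subst huv; rfl
    · simp only [huv, Ne.symm huv, if_false, G.adj_comm u v, add_comm]
  have hMq : ∀ y : Option V → ℝ, 0 ≤ ∑ i, ∑ j, y i * y j * M i j := by
    intro y
    have hgram : ∀ i j, gram (fun i => Pi.single none (y i) : Option V → Option V → ℝ) i j =
        y i * y j := fun i j => by simp [gram]
    have h := hfle _ ⟨fun i => Pi.single none (y i), rfl⟩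
    rw [← neg_nonneg, hfn] at h
    refine h.trans_eq ?_
    let A : V → V → ℝ := fun u v =>
      if u = v ∨ G.Adj u v then y (some u) * y (some v) * n (some u) (some v) else 0
    have hA : ∀ u v, y (some u) * y (some v) * M (some u) (some v) =
        (A u v + A v u) / 2 - if u = v then y (some u) * y (some u) * n none (some u) else 0 := by
      intro u v
      by_cases huv : u = v
      · subst huv; simp only [M, A, if_true, true_or]; ring
      · by_cases hadj : G.Adj u v
        · simp only [M, A, huv, hadj, G.adj_comm v u, Ne.symm huv, or_true, if_true, if_false]; ring
        · simp [M, A, huv, hadj, G.adj_comm v u, Ne.symm huv]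
    have hsym : ∑ u, ∑ v, (A u v + A v u) / 2 = ∑ u, ∑ v, A u v := by
      simp only [add_div, Finset.sum_add_distrib]
      rw [Finset.sum_comm (f := fun u v => A v u / 2), ← Finset.sum_add_distrib]
      refine Finset.sum_congr rfl fun u _ => ?_
      rw [← Finset.sum_add_distrib]
      exact Finset.sum_congr rfl fun v _ => by ring
    have hB : ∀ u v, prescribedEntries G
        (gram fun i => (Pi.single none (y i) : Option V → ℝ)) (some u) (some v) * n (some u) (some v) = A u v := by
      intro u v
      simp only [prescribedEntries, LinearMap.coe_mk, AddHom.coe_mk, hgram, A]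
      split_ifs <;> ring
    simp only [Fintype.sum_option, Finset.sum_add_distrib, hA, hB, Finset.sum_sub_distrib, hsym]
    simp only [prescribedEntries, LinearMap.coe_mk, AddHom.coe_mk, hgram, M, zero_mul,
      Finset.sum_const_zero, Finset.sum_ite_eq, Finset.mem_univ, if_true, sub_mul,
      Finset.sum_sub_distrib]
    have h1 : ∑ v, y none * y (some v) * (n none (some v) / 2) +
        ∑ v, y (some v) * y none * (n none (some v) / 2) =
        ∑ v, y none * y (some v) * n none (some v) := by
      rw [← Finset.sum_add_distrib]
      exact Finset.sum_congr rfl fun v _ => by ring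
    linarith
  obtain ⟨m, hm⟩ := exists_gram_eq_of_quadratic_nonneg M hMs hMq
  -- The quantity bounded here is -f at the target, whereas separation gives f > u > 0 there.
  have h := sum_add_sum_mul_nonneg_of_mem_TH hw m (fun u v huv hadj => by
    rw [hm]; simp [M, huv, hadj])
  have hT' : -f (targetEntries w) = n none none + ∑ v, w v * n (some v) (some v) := by
    rw [hfn]
    simp [Fintype.sum_option, targetEntries]
  simp only [hm, M, if_true] at h
  have : ∀ v, n (some v) (some v) - n none (some v) + 2 * (n none (some v) / 2) =
    n (some v) (some v) := fun v => by ring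
  simp only [this] at h
  linarith

end Duality

/-! ### Extreme points and polytopes -/

open Filter Topology

section Extreme

theorem eq_zero_of_eventually_add_smul_mem {E : Type*} [AddCommGroup E] [Module ℝ E] {X : Set E}
    {x f : E} (hx : x ∈ Set.extremePoints ℝ X) (h : ∀ᶠ ε in 𝓝 (0 : ℝ), x + ε • f ∈ X) :
    f = 0 := by
  have h' : ∀ᶠ ε in 𝓝 (0 : ℝ), x + (-ε) • f ∈ X :=
    (continuous_neg.tendsto' (0 : ℝ) 0 neg_zero).eventually h
  have h2 := ((h.and h').filter_mono nhdsWithin_le_nhds).and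
    (self_mem_nhdsWithin : Set.Ioi (0 : ℝ) ∈ 𝓝[>] 0)
  obtain ⟨ε, ⟨h1, h2⟩, hε⟩ := h2.exists
  have := ((mem_extremePoints.mp hx).2 _ h1 _ h2
    ⟨1 / 2, 1 / 2, by norm_num, by norm_num, by norm_num, by module⟩).1
  rw [add_eq_left, smul_eq_zero] at this
  exact this.resolve_left (ne_of_gt hε)

theorem eventually_add_mul_le {α β c : ℝ} (h : α ≤ c) (hβ : α = c → β = 0) :
    ∀ᶠ ε in 𝓝 (0 : ℝ), α + ε * β ≤ c := by
  rcases h.lt_or_eq with h | h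
  · have : Tendsto (fun ε : ℝ => α + ε * β) (𝓝 0) (𝓝 α) := by
      have hc : Continuous fun ε : ℝ => α + ε * β := by fun_prop
      simpa using hc.tendsto 0
    filter_upwards [this.eventually_lt_const h] with ε hε using hε.le
  · simp [hβ h, h]

variable {V : Type*} [Fintype V]

/-- An extreme point is determined by its set of tight inequalities: if x and y share that set, x +
ε(x - y) stays feasible for small ε of both signs. So there are finitely many, and Krein–Milman
applies. -/
theorem IsPolytope.exists_finite_eq_convexHull {X : Set (V → ℝ)} (hX : IsPolytope X) :
    ∃ F : Set (V → ℝ), F.Finite ∧ X = convexHull ℝ F := by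
  obtain ⟨hb, m, A, b, hXA⟩ := hX
  have hconv : Convex ℝ X := by
    intro x hx y hy s t hs ht hst
    rw [hXA] at hx hy ⊢
    intro i
    rw [dotProduct_add, dotProduct_smul, dotProduct_smul, smul_eq_mul, smul_eq_mul]
    have : s * b i + t * b i = b i := by rw [← add_mul, hst, one_mul]
    linarith [mul_le_mul_of_nonneg_left (hx i) hs, mul_le_mul_of_nonneg_left (hy i) ht]
  have hclosed : IsClosed X := by
    have : X = ⋂ i, {x | A i ⬝ᵥ x ≤ b i} := by rw [hXA]; ext x; simp
    rw [this]
    exact isClosed_iInter fun i =>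
      isClosed_le (continuous_const.dotProduct continuous_id) continuous_const
  have hfin : (Set.extremePoints ℝ X).Finite := by
    refine Set.Finite.of_injOn (f := fun x => {i | A i ⬝ᵥ x = b i}) (t := Set.univ)
      (fun _ _ => Set.mem_univ _) ?_ Set.finite_univ
    intro x hx y hy hxy
    refine sub_eq_zero.mp (eq_zero_of_eventually_add_smul_mem hx ?_)
    have : ∀ᶠ ε in 𝓝 (0 : ℝ), ∀ i, A i ⬝ᵥ x + ε * (A i ⬝ᵥ (x - y)) ≤ b i := by
      refine eventually_all.mpr fun i => eventually_add_mul_le ?_ fun hi => ?_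
      · have := hx.1
        rw [hXA] at this
        exact this i
      · have : i ∈ {i | A i ⬝ᵥ y = b i} := (Set.ext_iff.mp hxy i).mp hi
        rw [dotProduct_sub, hi, show A i ⬝ᵥ y = b i from this, sub_self]
    filter_upwards [this] with ε hε
    rw [hXA]
    intro i
    rw [dotProduct_add, dotProduct_smul, smul_eq_mul]
    exact hε i
  refine ⟨_, hfin, ?_⟩
  conv_lhs => rw [← closure_convexHull_extremePoints
    (Metric.isCompact_of_isClosed_isBounded hclosed hb) hconv]
  exact (hfin.isClosed_convexHull ℝ).closure_eq

theorem isPolytope_QSTAB (G : SimpleGraph V) : IsPolytope (QSTAB G) := by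
  classical
  refine ⟨isBounded_QSTAB G, ?_⟩
  let J := V ⊕ {Q : Finset V // G.IsClique (Q : Set V)}
  let e := Fintype.equivFin J
  let A : J → V → ℝ := Sum.elim (fun v => -Pi.single v 1) fun Q => charLabeling (Q.1 : Set V)
  let b : J → ℝ := Sum.elim (fun _ => 0) fun _ => 1
  refine ⟨Fintype.card J, fun i => A (e.symm i), fun i => b (e.symm i), ?_⟩
  ext x
  have : (∀ i, A (e.symm i) ⬝ᵥ x ≤ b (e.symm i)) ↔ ∀ j, A j ⬝ᵥ x ≤ b j :=
    e.symm.forall_congr_right (q := fun j => A j ⬝ᵥ x ≤ b j)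
  simp only [Set.mem_ofPred_eq, this, Sum.forall, J, A, b, Sum.elim_inl, Sum.elim_inr, QSTAB,
    neg_dotProduct, single_dotProduct, one_mul, Left.neg_nonpos_iff, Subtype.forall]
  refine and_congr Iff.rfl (forall₂_congr fun Q _ => ?_)
  rw [← sum_charLabeling_mul]
  rfl

/-- If `TH` of the complement is the convex hull of finitely many points, the stable set bound
is exact. -/
theorem TH_eq_STAB_of_compl_eq_convexHull {G : SimpleGraph V} {F : Set (V → ℝ)} (hF : F.Finite)
    (h : TH Gᶜ = convexHull ℝ F) : TH G = STAB G := by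
  refine Set.Subset.antisymm ?_ (STAB_subset_TH G)
  conv_lhs => rw [← closure_convexHull_extremePoints (isCompact_TH G) (convex_TH G)]
  refine closure_minimal (convexHull_min (fun w hw => ?_) (convex_convexHull ℝ _)) (isClosed_STAB G)
  obtain ⟨d, a, ha, hc⟩ := exists_labeling_compl_of_mem_TH hw.1
  have hzero : ∀ j ≠ 0, (fun v => a v 0 * a v j / (a v ⬝ᵥ a v)) = 0 := by
    intro j hj
    set f : V → ℝ := fun v => a v 0 * a v j / (a v ⬝ᵥ a v) with hf
    refine eq_zero_of_eventually_add_smul_mem hw ?_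
    -- Nonnegativity survives the perturbation because f vanishes wherever the cost w does.
    have h1 : ∀ᶠ ε in 𝓝 (0 : ℝ), ∀ v, -w v + ε * (-f v) ≤ 0 := by
      refine eventually_all.mpr fun v => eventually_add_mul_le ?_ fun hv => ?_
      · simpa using hw.1.1 v
      · have hv0 := hc v
        rw [neg_eq_zero.mp hv, cost_eq, div_eq_zero_iff, sq_eq_zero_iff] at hv0
        rcases hv0 with hv0 | hv0 <;> simp [hf, hv0]
    -- If p is tight at w, then the constraint of `a` is tight at p, so p is orthogonal to f.
    -- Finiteness of F allows a common range of ε.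
    have h2 : ∀ᶠ ε in 𝓝 (0 : ℝ), ∀ p ∈ F, ∑ v, p v * w v + ε * ∑ v, p v * f v ≤ 1 := by
      refine (eventually_all_finite hF).mpr fun p hp => ?_
      have hpT : p ∈ TH Gᶜ := by rw [h]; exact subset_convexHull ℝ F hp
      have heq : ∑ v, p v * w v = ∑ v, cost (a v) * p v :=
        Finset.sum_congr rfl fun v _ => by rw [hc, mul_comm]
      refine eventually_add_mul_le (heq.trans_le (hpT.2 d a ha)) fun hp1 => ?_
      exact sum_mul_eq_zero_of_tight hpT ha (by simpa only [hc] using hp1) hj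
    filter_upwards [h1, h2] with ε hε1 hε2
    refine mem_TH_of_compl_eq_convexHull h (fun v => ?_) fun p hp => ?_
    · have := hε1 v
      simp only [Pi.zero_apply, Pi.add_apply, Pi.smul_apply, smul_eq_mul]
      linarith
    · refine le_trans (le_of_eq ?_) (hε2 p hp)
      rw [Finset.mul_sum, ← Finset.sum_add_distrib]
      refine Finset.sum_congr rfl fun v _ => ?_
      simp only [Pi.add_apply, Pi.smul_apply, smul_eq_mul]
      ring
  obtain ⟨Q, hQ, hcQ⟩ := exists_isClique_cost_eq_charLabeling ha
    fun v j hj => congrFun (hzero j hj) v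
  refine subset_convexHull ℝ _ ⟨Q, (G.isClique_compl).mp hQ, ?_⟩
  funext v
  rw [← hc, hcQ]

theorem TH_eq_STAB_compl_of_isPolytope {G : SimpleGraph V} (h : IsPolytope (TH G)) :
    TH Gᶜ = STAB Gᶜ := by
  obtain ⟨F, hF, hG⟩ := h.exists_finite_eq_convexHull
  exact TH_eq_STAB_of_compl_eq_convexHull hF (by rwa [compl_compl])

theorem TH_eq_QSTAB_of_isPolytope {G : SimpleGraph V} (h : IsPolytope (TH G)) :
    TH G = QSTAB G :=
  TH_eq_QSTAB_of_compl (TH_eq_STAB_compl_of_isPolytope h)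

/-- Complementation is used twice: `QSTAB G` is a polytope, so `TH Gᶜ` is `STAB Gᶜ`, whose finitely
many generators then control `TH G`. -/
theorem TH_eq_STAB_of_eq_QSTAB {G : SimpleGraph V} (h : TH G = QSTAB G) : TH G = STAB G :=
  TH_eq_STAB_of_compl_eq_convexHull (finite_stable_charLabeling Gᶜ)
    (TH_eq_STAB_compl_of_isPolytope (h ▸ isPolytope_QSTAB G))

theorem TH_eq_QSTAB_of_eq_STAB {G : SimpleGraph V} (h : TH G = STAB G) : TH G = QSTAB G :=
  TH_eq_QSTAB_of_compl (TH_eq_STAB_of_compl_eq_convexHull (finite_stable_charLabeling G)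
    (by rwa [compl_compl]))

/-- A constraint of `TH G` that is tight at a basis comes from a maximal clique. -/
theorem exists_maximal_clique_of_tight {G : SimpleGraph V} {d : ℕ} {a : V → Fin (d + 1) → ℝ}
    (ha : IsOrthogonalLabeling G a) {x : Fin (Fintype.card V) → V → ℝ}
    (hx : LinearIndependent ℝ x) (hmem : ∀ k, x k ∈ TH G)
    (ht : ∀ k, ∑ v, x k v * cost (a v) = 1) :
    ∃ Q : Set V, Maximal (fun S : Set V => G.IsClique S) Q ∧
      ∀ v, cost (a v) = charLabeling Q v := by
  classical
  have hspan : ∀ f : V → ℝ, (∀ k, x k ⬝ᵥ f = 0) → f = 0 := by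
    intro f hf
    have htop := hx.span_eq_top_of_card_eq_finrank' (by simp)
    have hall : ∀ y : V → ℝ, y ⬝ᵥ f = 0 := by
      intro y
      have hy : y ∈ Submodule.span ℝ (Set.range x) := htop ▸ Submodule.mem_top
      induction hy using Submodule.span_induction with
      | mem y hy => obtain ⟨k, rfl⟩ := hy; exact hf k
      | zero => simp
      | add y z _ _ hy hz => rw [add_dotProduct, hy, hz, add_zero]
      | smul c y _ hy => rw [smul_dotProduct, hy, smul_zero]
    exact dotProduct_self_eq_zero.mp (hall f)
  obtain ⟨Q, hQ, hc⟩ := exists_isClique_cost_eq_charLabeling ha fun v j hj =>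
    congrFun (hspan (fun v => a v 0 * a v j / (a v ⬝ᵥ a v))
      fun k => sum_mul_eq_zero_of_tight (hmem k) ha (ht k) hj) v
  refine ⟨Q, ⟨hQ, fun R hR hQR u hu => ?_⟩, hc⟩
  by_contra huQ
  -- The weights on Q already sum to 1, so a larger clique containing u forces weight 0 at u in
  -- every x k, against spanning.
  have hzero : ∀ k, x k ⬝ᵥ Pi.single u 1 = 0 := by
    intro k
    rw [dotProduct_single, mul_one]
    have hxQ := TH_subset_QSTAB G (hmem k)
    refine le_antisymm ?_ (hxQ.1 u)
    have h1 := hxQ.2 (insert u Q.toFinset)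
      (hR.subset (by simpa [Set.insert_subset_iff] using ⟨hu, hQR⟩))
    rw [Finset.sum_insert (by simpa using huQ), ← sum_charLabeling_mul, Set.coe_toFinset] at h1
    have h2 := ht k
    simp only [hc, mul_comm (x k _)] at h2
    linarith
  simpa using congrFun (hspan _ hzero) u

end Extreme

/-! ### Perfection and the equality of STAB and QSTAB -/

section Perfect

variable {V : Type*} [Fintype V]

theorem sum_charLabeling_eq_card {V : Type*} [DecidableEq V] (Q : Finset V) (U : Set V)
    [DecidablePred (· ∈ U)] : ∑ v ∈ Q, charLabeling U v = ((Q.filter (· ∈ U)).card : ℝ) := by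
  simp only [charLabeling, Set.indicator_apply]
  rw [Finset.sum_boole]

/-- If the clique constraints describe the stable set polytope, then some stable set meets all
largest cliques inside a given set of vertices. -/
theorem exists_isIndepSet_meeting_cliques {G : SimpleGraph V} (h : QSTAB G ⊆ STAB G) {k : ℕ}
    {U : Set V} (hU : ∀ Q : Finset V, G.IsClique (Q : Set V) → (Q : Set V) ⊆ U → Q.card ≤ k + 1) :
    ∃ S : Set V, G.IsIndepSet S ∧ ∀ Q : Finset V, G.IsClique (Q : Set V) → (Q : Set V) ⊆ U →
      Q.card = k + 1 → ∃ v ∈ Q, v ∈ S := by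
  classical
  have hk : (0 : ℝ) < k + 1 := by positivity
  have hsum : ∀ Q : Finset V, ∑ v ∈ Q, ((1 / (k + 1 : ℝ)) • charLabeling U) v =
      ((Q.filter (· ∈ U)).card : ℝ) / (k + 1) := fun Q => by
    simp only [Pi.smul_apply, smul_eq_mul, ← Finset.mul_sum, sum_charLabeling_eq_card]
    ring
  have hx : (1 / (k + 1 : ℝ)) • charLabeling U ∈ QSTAB G := by
    refine ⟨smul_nonneg (by positivity) (Set.indicator_nonneg fun _ _ => zero_le_one), ?_⟩
    intro Q hQ
    rw [hsum, div_le_one hk]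
    exact_mod_cast hU (Q.filter (· ∈ U)) (hQ.subset fun v hv => (Finset.mem_filter.mp hv).1) (fun v => by simp)
  obtain ⟨ι, _, w, z, hw, hw1, hz, hzx⟩ := mem_convexHull_iff_exists_fintype.mp (h hx)
  obtain ⟨i, hi⟩ : ∃ i, 0 < w i := by
    by_contra! hcon
    have : ∑ i, w i ≤ 0 := Finset.sum_nonpos fun i _ => hcon i
    linarith
  obtain ⟨S, hS, hzS⟩ := hz i
  -- Any stable set of positive weight works: the average of the clique sums over Q is 1 and none
  -- exceeds 1, so S cannot miss Q.
  refine ⟨S, hS, fun Q hQ hQU hcard => ?_⟩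
  by_contra! hQS
  have hle : ∀ j, ∑ v ∈ Q, z j v ≤ 1 := fun j =>
    (TH_subset_QSTAB G (STAB_subset_TH G (subset_convexHull ℝ _ (hz j)))).2 Q hQ
  have h0 : ∑ v ∈ Q, z i v = 0 :=
    Finset.sum_eq_zero fun v hv => by rw [hzS]; simp [charLabeling, hQS v hv]
  have h1 : ∑ v ∈ Q, ((1 / (k + 1 : ℝ)) • charLabeling U) v = 1 := by
    rw [hsum, Finset.filter_true_of_mem (fun v hv => hQU hv), hcard]
    push_cast
    exact div_self hk.ne'
  have h2 : ∑ v ∈ Q, (∑ j, w j • z j) v = ∑ j, w j * ∑ v ∈ Q, z j v := by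
    simp only [Finset.sum_apply, Pi.smul_apply, smul_eq_mul, Finset.mul_sum]
    exact Finset.sum_comm
  rw [hzx, h1] at h2
  have h3 : ∑ j, w j * ∑ v ∈ Q, z j v < ∑ j, w j :=
    Finset.sum_lt_sum (fun j _ => mul_le_of_le_one_right (hw j) (hle j))
      ⟨i, Finset.mem_univ i, by rw [h0, mul_zero]; exact hi⟩
  linarith

/-- Removing a stable set that meets all largest cliques lowers the clique bound by one; that set
becomes the new color class. -/
theorem exists_coloring_of_QSTAB_subset_STAB {G : SimpleGraph V} (h : QSTAB G ⊆ STAB G) (k : ℕ) :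
    ∀ U : Set V, (∀ Q : Finset V, G.IsClique (Q : Set V) → (Q : Set V) ⊆ U → Q.card ≤ k) →
      ∃ c : V → ℕ, (∀ v ∈ U, c v < k) ∧ ∀ u ∈ U, ∀ v ∈ U, G.Adj u v → c u ≠ c v := by
  classical
  induction k with
  | zero =>
    intro U hU
    have : ∀ v, v ∉ U := fun v hv => by simpa using hU {v} (by simp) (by simpa using hv)
    exact ⟨fun _ => 0, fun v hv => absurd hv (this v), fun v hv => absurd hv (this v)⟩
  | succ k ih =>
    intro U hU
    obtain ⟨S, hS, hmeet⟩ := exists_isIndepSet_meeting_cliques h hU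
    obtain ⟨c, hck, hc⟩ := ih (U \ S) fun Q hQ hQU => by
      have hQU' : (Q : Set V) ⊆ U := hQU.trans Set.sdiff_subset
      refine Nat.le_of_lt_succ (lt_of_le_of_ne (hU Q hQ hQU') fun hcard => ?_)
      obtain ⟨v, hvQ, hvS⟩ := hmeet Q hQ hQU' hcard
      exact (hQU hvQ).2 hvS
    refine ⟨fun v => if v ∈ S then k else c v, fun v hv => ?_, fun u hu v hv huv => ?_⟩
    · by_cases hvS : v ∈ S
      · simp [hvS]
      · simpa [hvS] using (hck v ⟨hv, hvS⟩).trans (Nat.lt_succ_self k)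
    · by_cases huS : u ∈ S <;> by_cases hvS : v ∈ S
      · exact absurd huv (hS huS hvS huv.ne)
      · simpa [huS, hvS] using (hck v ⟨hv, hvS⟩).ne'
      · simpa [huS, hvS] using (hck u ⟨hu, huS⟩).ne
      · simpa [huS, hvS] using hc u ⟨hu, huS⟩ v ⟨hv, hvS⟩ huv

theorem isPerfect_of_QSTAB_subset_STAB {G : SimpleGraph V} (h : QSTAB G ⊆ STAB G) :
    IsPerfect G := by
  classical
  intro U
  obtain ⟨c, hck, hc⟩ := exists_coloring_of_QSTAB_subset_STAB h (G.induce U).cliqueNum U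
    fun Q hQ hQU => by
      have hclique : (G.induce U).IsClique (Q.subtype (· ∈ U) : Set U) := by
        intro u hu v hv huv
        exact hQ (by simpa using hu) (by simpa using hv) (fun h => huv (Subtype.ext h))
      have := hclique.card_le_cliqueNum
      rwa [Finset.card_subtype, Finset.filter_true_of_mem (fun v hv => hQU hv)] at this
  exact ⟨SimpleGraph.Coloring.mk (fun v : U => (⟨c v, hck v v.2⟩ : Fin _)) fun {u v} huv heq =>
    hc u u.2 v v.2 huv (Fin.mk.inj_iff.mp heq)⟩

theorem card_filter_mem_le_one {V : Type*} {G : SimpleGraph V} {Q : Finset V} {S : Set V}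
    [DecidablePred (· ∈ S)] (hQ : G.IsClique (Q : Set V)) (hS : G.IsIndepSet S) :
    ∑ v ∈ Q, (if v ∈ S then 1 else 0) ≤ 1 := by
  rw [Finset.sum_boole]
  refine Finset.card_le_one.mpr fun u hu v hv => ?_
  rw [Finset.mem_filter] at hu hv
  by_contra huv
  exact hS hu.2 hv.2 huv (hQ hu.1 hv.1 huv)

open Classical in
/-- The weighted form of the perfect graph coloring property, by replication of vertices. -/
theorem IsPerfect.exists_stable_cover {G : SimpleGraph V} (h : IsPerfect G) (s : ℕ) :
    ∀ (w : V → ℕ) (N : ℕ), ∑ v, w v ≤ s →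
      (∀ Q : Finset V, G.IsClique (Q : Set V) → ∑ v ∈ Q, w v ≤ N) →
      ∃ S : Fin N → Set V, (∀ i, G.IsIndepSet (S i)) ∧
        ∀ v, ∑ i, (if v ∈ S i then 1 else 0) = w v := by
  induction s with
  | zero =>
    intro w N hs _
    refine ⟨fun _ => ∅, by simp, fun v => ?_⟩
    have := Finset.single_le_sum (f := w) (fun _ _ => Nat.zero_le _) (Finset.mem_univ v)
    simp; omega
  | succ s ih =>
    intro w N hs hw
    by_cases hw2 : ∃ u, 2 ≤ w u
    · obtain ⟨u, hu⟩ := hw2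
      let w₁ : V → ℕ := fun v => if v = u then w v - 1 else w v
      have hw₁ : ∀ v, w₁ v ≤ w v := fun v => by simp only [w₁]; split_ifs <;> omega
      have hw₁u : w₁ u + 1 = w u := by simp only [w₁, if_true]; omega
      have hsum₁ : ∑ v, w₁ v < ∑ v, w v :=
        Finset.sum_lt_sum (fun v _ => hw₁ v) ⟨u, Finset.mem_univ u, by omega⟩
      obtain ⟨S, hS, hcov⟩ := ih w₁ N (by omega)
        fun Q hQ => (Finset.sum_le_sum fun v _ => hw₁ v).trans (hw Q hQ)
      obtain ⟨i₀, hi₀⟩ : ∃ i, u ∈ S i := by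
        by_contra! hcon
        have := hcov u
        simp only [hcon, if_false, Finset.sum_const_zero] at this
        omega
      obtain ⟨M, rfl⟩ : ∃ M, N = M + 1 := ⟨N - 1, by have := i₀.2; omega⟩
      have hA : ∀ v ∈ S i₀, 1 ≤ w₁ v := fun v hv => by
        rw [← hcov v]
        have := Finset.single_le_sum (f := fun i => if v ∈ S i then 1 else 0)
          (fun _ _ => Nat.zero_le _) (Finset.mem_univ i₀)
        simpa [hv] using this
      -- This is w minus the indicator of `S i₀`, as `w₁` already dropped by one at u. A clique
      -- loses weight if it meets `S i₀` (at u or elsewhere). If it misses `S i₀`, only the other M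
      -- stable sets can cover its `w₁`-weight, each at most once.
      let w₂ : V → ℕ := fun v => w₁ v - if v ∈ S i₀ ∧ v ≠ u then 1 else 0
      have hw₂ : ∀ v, w₂ v ≤ w₁ v := fun v => Nat.sub_le _ _
      obtain ⟨T, hT, hcovT⟩ := ih w₂ M
        (by have := Finset.sum_le_sum fun v (_ : v ∈ Finset.univ) => hw₂ v; omega) fun Q hQ => by
          refine Nat.le_of_lt_succ ?_
          by_cases h1 : ∃ v ∈ Q, v ∈ S i₀ ∧ v ≠ u
          · obtain ⟨v, hvQ, hv⟩ := h1
            have hlt : ∑ v ∈ Q, w₂ v < ∑ v ∈ Q, w₁ v :=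
              Finset.sum_lt_sum (fun v _ => hw₂ v) ⟨v, hvQ, by
                have := hA v hv.1
                simp only [w₂, hv, ne_eq, not_false_eq_true, and_self, if_true]; omega⟩
            have := Finset.sum_le_sum fun v (_ : v ∈ Q) => hw₁ v
            have := hw Q hQ
            omega
          · have hle := Finset.sum_le_sum fun v (_ : v ∈ Q) => hw₂ v
            by_cases huQ : u ∈ Q
            · have hlt : ∑ v ∈ Q, w₁ v < ∑ v ∈ Q, w v :=
                Finset.sum_lt_sum (fun v _ => hw₁ v) ⟨u, huQ, by omega⟩
              have := hw Q hQ
              omega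
            · have hlt : ∑ v ∈ Q, w₁ v < ∑ _i : Fin (M + 1), 1 := by
                simp only [← hcov]
                rw [Finset.sum_comm]
                refine Finset.sum_lt_sum (fun i _ => card_filter_mem_le_one hQ (hS i))
                  ⟨i₀, Finset.mem_univ i₀, ?_⟩
                rw [Finset.sum_eq_zero]
                · exact zero_lt_one
                · intro v hv
                  refine if_neg fun hvS => h1 ⟨v, hv, hvS, ?_⟩
                  rintro rfl
                  exact huQ hv
              simp only [Finset.sum_const, Finset.card_univ, Fintype.card_fin, smul_eq_mul,
                mul_one] at hlt
              omega
      refine ⟨Fin.cons (S i₀) T, Fin.cases (hS i₀) hT, fun v => ?_⟩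
      rw [Fin.sum_univ_succ]
      simp only [Fin.cons_zero, Fin.cons_succ, hcovT]
      by_cases hvu : v = u
      · subst hvu
        simp only [w₂, hi₀, if_true, ne_eq, not_true_eq_false, and_false, if_false]
        omega
      · by_cases hv : v ∈ S i₀
        · have h3 := hA v hv
          have h4 : w₁ v = w v := by simp [w₁, hvu]
          simp only [w₂, hv, hvu, ne_eq, not_false_eq_true, and_self, if_true]
          omega
        · simp [w₂, w₁, hv, hvu]
    · push Not at hw2
      -- All weights are now 0 or 1, so the cover is an ordinary coloring of an induced subgraph.
      let U : Set V := {v | w v = 1}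
      obtain ⟨Q, hQ⟩ := (G.induce U).exists_isNClique_cliqueNum
      have hle : (G.induce U).cliqueNum ≤ N := by
        have hclique : G.IsClique (Q.map (Function.Embedding.subtype (· ∈ U)) : Set V) := by
          intro a ha b hb hab
          simp only [Finset.coe_map, Function.Embedding.subtype_apply, Set.mem_image] at ha hb
          obtain ⟨a, ha, rfl⟩ := ha
          obtain ⟨b, hb, rfl⟩ := hb
          exact hQ.isClique ha hb (fun h => hab (by rw [h]))
        have := hw _ hclique
        rw [Finset.sum_map] at this
        rw [← hQ.card_eq, Finset.card_eq_sum_ones]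
        exact le_trans (le_of_eq (Finset.sum_congr rfl fun v _ => v.2.symm)) this
      obtain ⟨C⟩ := (h U).mono hle
      refine ⟨fun i => {v | ∃ hv : v ∈ U, C ⟨v, hv⟩ = i}, fun i => ?_, fun v => ?_⟩
      · rintro a ⟨ha, hai⟩ b ⟨hb, hbi⟩ hab hadj
        exact C.valid (v := ⟨a, ha⟩) (w := ⟨b, hb⟩) hadj (hai.trans hbi.symm)
      · by_cases hv : v ∈ U
        · have h1 : w v = 1 := hv
          simp [hv, h1]
        · have h1 : w v ≠ 1 := hv
          have h2 := hw2 v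
          simp [hv]
          omega

/-- The integer weights ⌊N x⌋ obey the clique bound N, so ⌊N x⌋ / N is an average of N stable sets.
It tends to x, and `STAB G` is closed. -/
theorem IsPerfect.QSTAB_subset_STAB {G : SimpleGraph V} (h : IsPerfect G) :
    QSTAB G ⊆ STAB G := by
  classical
  intro x hx
  have hlim : Tendsto (fun N : ℕ => fun v => (⌊x v * N⌋₊ : ℝ) / N) atTop (𝓝 x) :=
    tendsto_pi_nhds.mpr fun v =>
      (tendsto_nat_floor_mul_div_atTop (hx.1 v)).comp tendsto_natCast_atTop_atTop
  refine (isClosed_STAB G).mem_of_tendsto hlim ?_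
  filter_upwards [eventually_gt_atTop 0] with N hN
  have hN' : (0 : ℝ) < N := by exact_mod_cast hN
  obtain ⟨S, hS, hcov⟩ := h.exists_stable_cover _ (fun v => ⌊x v * N⌋₊) N le_rfl fun Q hQ => by
    have h1 : ((∑ v ∈ Q, ⌊x v * N⌋₊ : ℕ) : ℝ) ≤ ∑ v ∈ Q, x v * N := by
      push_cast
      exact Finset.sum_le_sum fun v _ => Nat.floor_le (mul_nonneg (hx.1 v) hN'.le)
    rw [← Finset.sum_mul] at h1
    have h2 := hx.2 Q hQ
    have h3 : ((∑ v ∈ Q, ⌊x v * N⌋₊ : ℕ) : ℝ) ≤ N :=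
      h1.trans (mul_le_of_le_one_left hN'.le h2)
    exact_mod_cast h3
  have hmem := (convex_convexHull ℝ {x : V → ℝ | ∃ S : Set V, G.IsIndepSet S ∧
    x = charLabeling S}).sum_mem (t := Finset.univ) (w := fun _ : Fin N => 1 / (N : ℝ))
    (z := fun i => charLabeling (S i)) (fun _ _ => by positivity)
    (by simp [hN'.ne']) (fun i _ => subset_convexHull ℝ _ ⟨S i, hS i, rfl⟩)
  refine Eq.subst (motive := (· ∈ STAB G)) (funext fun v => ?_) hmem
  simp only [Finset.sum_apply, Pi.smul_apply, smul_eq_mul, ← Finset.mul_sum]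
  rw [← hcov v]
  push_cast
  simp only [charLabeling, Set.indicator_apply]
  ring

end Perfect

end Sandwich

theorem corollary34 {V : Type*} [Fintype V] (G : SimpleGraph V) :
    -- a constraint tight at `n` linearly independent points comes from a maximal clique
    (∀ (d : ℕ) (a : V → Fin (d + 1) → ℝ), Sandwich.IsOrthogonalLabeling G a →
      ∀ x : Fin (Fintype.card V) → V → ℝ, LinearIndependent ℝ x →
        (∀ k, x k ∈ Sandwich.TH G) →
        (∀ k, ∑ v, x k v * Sandwich.cost (a v) = 1) →
        ∃ Q : Set V, Maximal (fun S : Set V => G.IsClique S) Q ∧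
          ∀ v, Sandwich.cost (a v) = Sandwich.charLabeling Q v) ∧
    (Sandwich.IsPolytope (Sandwich.TH G) ↔ Sandwich.TH G = Sandwich.QSTAB G) ∧
    (Sandwich.TH G = Sandwich.QSTAB G ↔ Sandwich.TH G = Sandwich.STAB G) ∧
    (Sandwich.TH G = Sandwich.STAB G ↔ Sandwich.IsPerfect G) := by
  refine ⟨fun d a ha x hx hmem ht => Sandwich.exists_maximal_clique_of_tight ha hx hmem ht,
    ⟨Sandwich.TH_eq_QSTAB_of_isPolytope, fun h => h ▸ Sandwich.isPolytope_QSTAB G⟩,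
    ⟨Sandwich.TH_eq_STAB_of_eq_QSTAB, Sandwich.TH_eq_QSTAB_of_eq_STAB⟩, fun h => ?_, fun h => ?_⟩
  · exact Sandwich.isPerfect_of_QSTAB_subset_STAB
      ((Sandwich.TH_eq_QSTAB_of_eq_STAB h).symm.trans h).subset
  · exact ((Sandwich.TH_subset_QSTAB G).trans h.QSTAB_subset_STAB).antisymm
      (Sandwich.STAB_subset_TH G)
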